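/- Let $(\mathcal A,\mathcal B,\mathfrak F,d,\tau)$ be a fusion bialgebra: $\mathcal A$ and $\mathcal B$ are finite-dimensional C*-algebras with faithful (positive) traces $d$ and $\tau$; $\mathcal A$ is commutative, with product $\diamond$ and involution $\#$; $\mathfrak F:\mathcal A\to\mathcal B$ is a linear bijection with $\tau(\mathfrak F(x)^*\mathfrak F(y))=d(x^\#\diamond y)$ for all $x,y\in\mathcal A$; and, writing $x*y:=\mathfrak F^{-1}(\mathfrak F(x)\mathfrak F(y))$ for the convolution on $\mathcal A$, (i) $x*y\ge 0$ whenever $x,y\ge 0$ in $\mathcal A$; (ii) $J(x):=\mathfrak F^{-1}(\mathfrak F(x)^*)$ is an antilinear $*$-isomorphism of $\mathcal A$; (iii) $\mathfrak F^{-1}(1)$ is a positive multiple of a minimal projection of $\mathcal A$. Assume that $d$ is the Frobenius--Perron dimension function, i.e. $d(p)=\|\mathfrak F(p)\|$ (the C*-norm of $\mathcal B$) for every minimal projection $p$ of $\mathcal A$. Equivalently, $d(\mathfrak F^{-1}(x_j))=\|x_j\|$ for the basis $\{x_j\}$ of $\mathcal B$ consisting of suitable positive multiples of the elements $\mathfrak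 F(p)$; for instance, this holds for the canonical fusion bialgebra of a C*-algebra with an $\mathbb R_{\ge0}$-basis, in particular of a fusion ring. For $x\in\mathcal A$ let $\mathcal R(x)$ be its range projection (the least projection $p$ with $p\diamond x=x$) and $\mathcal S(x)=d(\mathcal R(x))$. A biprojection is a projection $B\in\mathcal A$ such that $\mathfrak F(B)$ is a multiple of a projection of $\mathcal B$; a right shift of $B$ is a projection $B_h\in\mathcal A$ with $d(B_h)=d(B)$ and $B*B_h=d(B)B_h$. Theorem (Exact inverse sum set theorem). For nonzero projections $P,Q\in\mathcal A$ the following are equivalent: (1) $\mathcal S(P*Q)=\mathcal S(P)$; (2) $\frac{1}{\mathcal S(Q)}\,P*Q$ is a projection; (3) there are a biprojection $B$ and a right shift $B_h$ of $B$ such that $Q\le B_h$, and $P=\mathcal R(x*B)$ for some $x\neq 0$ in $\mathcal A$. -/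

import Mathlib

open scoped ComplexOrder

noncomputable section

/-- A faithful (positive, tracial) functional on a complex *-algebra. -/
structure IsFaithfulTrace {C : Type*} [Ring C] [StarRing C] [Algebra ℂ C]
    (t : C →ₗ[ℂ] ℂ) : Prop where
  nonneg : ∀ x, 0 ≤ t (star x * x)
  faithful : ∀ x, t (star x * x) = 0 → x = 0
  trace : ∀ x y, t (x * y) = t (y * x)

/-- A minimal projection: a nonzero projection with no projection strictly between it and `0`. -/
def IsMinimalProjection {C : Type*} [Ring C] [StarRing C] [PartialOrder C] (p : C) : Prop :=
  IsStarProjection p ∧ p ≠ 0 ∧ ∀ q, IsStarProjection q → q ≤ p → q = 0 ∨ q = p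

/-- The range projection of `x`: the spectral projection of `x * star x` for the nonzero part of
its spectrum.  In a finite-dimensional C*-algebra this is the least projection `p` with `p * x = x`,
see `isLeast_rangeProjection`. -/
def rangeProjection {C : Type*} [CStarAlgebra C] (x : C) : C :=
  cfc (fun t : ℝ => if t = 0 then 0 else 1) (x * star x)

theorem finite_real_spectrum_of_finiteDimensional {C : Type*} [CStarAlgebra C]
    [FiniteDimensional ℂ C] (a : C) : (spectrum ℝ a).Finite := by
  have : FiniteDimensional ℝ C := FiniteDimensional.complexToReal C
  have hne : minpoly ℝ a ≠ 0 := minpoly.ne_zero (Algebra.IsIntegral.isIntegral a)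
  refine ((minpoly ℝ a).roots.toFinset.finite_toSet).subset ?_
  intro r hr
  have h := spectrum.subset_polynomial_aeval a (minpoly ℝ a) ⟨r, hr, rfl⟩
  rw [minpoly.aeval] at h
  have h0 : (minpoly ℝ a).eval r = 0 := by
    by_contra hc
    rw [spectrum.mem_iff] at h
    apply h
    rw [sub_zero]
    exact (IsUnit.mk0 _ hc).map (algebraMap ℝ C)
  simp only [Finset.mem_coe, Multiset.mem_toFinset]
  exact (Polynomial.mem_roots hne).2 h0

theorem isLeast_rangeProjection {C : Type*} [CStarAlgebra C] [PartialOrder C] [StarOrderedRing C]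
    [FiniteDimensional ℂ C] (x : C) :
    IsLeast {p : C | IsStarProjection p ∧ p * x = x} (rangeProjection x) := by
  have hsa : IsSelfAdjoint (x * star x) := IsSelfAdjoint.mul_star_self x
  have hfin : (spectrum ℝ (x * star x)).Finite := finite_real_spectrum_of_finiteDimensional _
  have hc : ∀ f : ℝ → ℝ, ContinuousOn f (spectrum ℝ (x * star x)) := fun f =>
    hfin.continuousOn f
  have hp : IsStarProjection (rangeProjection x) := by
    refine ⟨?_, cfc_predicate _ _⟩
    unfold IsIdempotentElem rangeProjection
    rw [← cfc_mul _ _ _ (hc _) (hc _)]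
    congr 1
    funext t
    split_ifs <;> simp
  have hpa : rangeProjection x * (x * star x) = x * star x := by
    conv_lhs => rw [← cfc_id' ℝ (x * star x) hsa]
    unfold rangeProjection
    rw [cfc_id' ℝ (x * star x) hsa]
    nth_rewrite 2 [← cfc_id' ℝ (x * star x) hsa]
    rw [← cfc_mul _ _ _ (hc _) (hc _)]
    conv_rhs => rw [← cfc_id' ℝ (x * star x) hsa]
    congr 1
    funext t
    split_ifs with h <;> simp [h]
  refine ⟨⟨hp, ?_⟩, ?_⟩
  · rw [← sub_eq_zero, ← CStarRing.mul_star_self_eq_zero_iff]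
    have h1 : x * star x * rangeProjection x = x * star x := by
      have := congrArg star hpa
      simpa [hp.isSelfAdjoint.star_eq, mul_assoc] using this
    rw [star_sub, star_mul, hp.isSelfAdjoint.star_eq]
    have e : (rangeProjection x * x - x) * (star x * rangeProjection x - star x)
        = rangeProjection x * (x * star x * rangeProjection x)
          - rangeProjection x * (x * star x)
          - (x * star x * rangeProjection x - x * star x) := by noncomm_ring
    rw [e, h1, hpa]
    simp
  · rintro q ⟨hq, hqx⟩
    refine hp.le_of_mul_eq_right hq ?_
    have : rangeProjection x = (x * star x) * cfc (fun t : ℝ => t⁻¹) (x * star x) := by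
      conv_rhs => 
        arg 1
        rw [← cfc_id' ℝ (x * star x) hsa]
      unfold rangeProjection
      rw [← cfc_mul _ _ _ (hc _) (hc _)]
      congr 1
      funext t
      split_ifs with h <;> simp [h]
    rw [this, ← mul_assoc, ← mul_assoc, hqx]

/-- A fusion bialgebra `(A, B, 𝔉, d, τ)`: finite-dimensional C*-algebras `A` (commutative) and `B`
with faithful traces `d` and `τ` and a unitary `𝔉 : A → B`.  The product and the involution of `A`
are written `*` and `star`; the convolution of `A` is `FusionBialgebra.conv` below. -/
structure FusionBialgebra (A B : Type*) [CommCStarAlgebra A] [PartialOrder A] [StarOrderedRing A]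
    [FiniteDimensional ℂ A] [CStarAlgebra B] [FiniteDimensional ℂ B] where
  /-- the Fourier transform -/
  fourier : A ≃ₗ[ℂ] B
  /-- the trace of `A` -/
  d : A →ₗ[ℂ] ℂ
  /-- the trace of `B` -/
  τ : B →ₗ[ℂ] ℂ
  d_trace : IsFaithfulTrace d
  τ_trace : IsFaithfulTrace τ
  plancherel : ∀ x y, τ (star (fourier x) * fourier y) = d (star x * y)
  schur : ∀ x y, 0 ≤ x → 0 ≤ y → 0 ≤ fourier.symm (fourier x * fourier y)
  /-- The bijective antilinear map `J x = 𝔉⁻¹ ((𝔉 x)^*)` is multiplicative on `A`. -/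
  modular_mul : ∀ x y, fourier.symm (star (fourier (x * y))) =
    fourier.symm (star (fourier x)) * fourier.symm (star (fourier y))
  /-- `J` commutes with the involution of `A`. -/
  modular_star : ∀ x, fourier.symm (star (fourier (star x))) =
    star (fourier.symm (star (fourier x)))
  jones : ∃ c : ℝ, 0 < c ∧ ∃ e : A, IsMinimalProjection e ∧ fourier.symm 1 = (c : ℂ) • e

namespace FusionBialgebra

variable {A B : Type*} [CommCStarAlgebra A] [PartialOrder A] [StarOrderedRing A]
  [FiniteDimensional ℂ A] [CStarAlgebra B] [FiniteDimensional ℂ B]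

/-- The convolution of `A`, induced by the product of `B`. -/
def conv (𝓕 : FusionBialgebra A B) (x y : A) : A :=
  𝓕.fourier.symm (𝓕.fourier x * 𝓕.fourier y)

/-- `d` is the Frobenius-Perron dimension function: the basis elements of `B` are the positive
multiples of the `𝔉 p`, for `p` a minimal projection of `A`, and `d ∘ 𝔉⁻¹` takes on each of them the
value of its operator norm. -/
def IsDimension (𝓕 : FusionBialgebra A B) : Prop :=
  ∀ p : A, IsMinimalProjection p → 𝓕.d p = (‖𝓕.fourier p‖ : ℂ)

/-- The size `𝒮(x) = d(ℛ(x))` of the support of `x`. -/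
def supp (𝓕 : FusionBialgebra A B) (x : A) : ℂ := 𝓕.d (rangeProjection x)

/-- A projection whose Fourier transform is a multiple of a projection. -/
def IsBiprojection (𝓕 : FusionBialgebra A B) (E : A) : Prop :=
  IsStarProjection E ∧ ∃ (c : ℂ) (p : B), IsStarProjection p ∧ 𝓕.fourier E = c • p

/-- `R` is a right shift of the biprojection `E`. -/
def IsRightShift (𝓕 : FusionBialgebra A B) (E R : A) : Prop :=
  IsStarProjection R ∧ 𝓕.d E = 𝓕.d R ∧ 𝓕.conv E R = 𝓕.d E • R

end FusionBialgebra

end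

open Filter Topology WeakDual

/-! ### Spectral projections, positivity and traces in C*-algebras. -/

section CStar

/-! Write `E` for the biprojection and `R` for its right shift. The dimension hypothesis enters
through Perron-Frobenius: `d ∘ 𝔉⁻¹` is multiplicative (`d_conv`) and `1` is an eigenvector of every
convolution, `1 * x = d(x) 1` (`one_conv`). Since `P ≤ 1`, it follows that `P * Q ≤ d(Q) W`, where
`W` is the range projection of `P * Q`. Applying `d` gives `d(P) ≤ d(W)`, and by faithfulness
equality means `P * Q = d(Q) W`. This is (1) ↔ (2).

For (1) → (3), the adjoint of convolution by `Q` on the right is convolution by `J Q`, and equality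
forces `P * Q * J Q = d(Q)² P`. So `𝔉 P` is fixed on the right by `d(Q)⁻² 𝔉(Q) 𝔉(Q)^*`, a positive
contraction because `‖𝔉 Q‖ ≤ d(Q)`. Its powers converge to a projection `f` of `B`, and `𝔉⁻¹ f` is a
limit of positive elements of `A`. Any such projection yields a biprojection
(`symm_projection_mul_self`). It absorbs `P`, and its convolution with `Q` is a multiple of a right
shift above `Q`.

For (3) → (1), `P * E = d(E) P` by equality in a Schwarz inequality, and `R * J R = d(E) E`. Hence
convolution by `R` and then by `J R` returns a multiple of `P`, so the support of `P * R`, and a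
fortiori that of `P * Q`, is no larger than `P` in dimension. -/

theorem Set.Finite.tendstoUniformlyOn_of_pointwise {ι α β : Type*} [UniformSpace β] {s : Set α}
    (hs : s.Finite) {F : ι → α → β} {f : α → β} {l : Filter ι}
    (h : ∀ x ∈ s, Tendsto (fun n => F n x) l (𝓝 (f x))) : TendstoUniformlyOn F f l s := by
  intro u hu
  rw [Filter.eventually_all_finite hs]
  intro x hx
  exact (tendstoUniformlyOn_singleton_iff_tendsto.2 (h x hx) u hu).mono fun n hn => hn x rfl

/-- The powers of `r⁻¹ • (b * star b)` converge to the spectral projection at `r`, provided that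
`r` bounds the spectrum of `b * star b`. -/
theorem exists_tendsto_pow_projection {B : Type*} [CStarAlgebra B] [FiniteDimensional ℂ B]
    (b : B) {r : ℝ} (hr : 0 < r) (hb : ‖b‖ ^ 2 ≤ r) :
    ∃ f : B, IsStarProjection f ∧ b * star b * f = (r : ℂ) • f ∧
      Tendsto (fun n : ℕ => ((r : ℂ)⁻¹ • (b * star b)) ^ n) atTop (𝓝 f) ∧
      (‖b‖ ^ 2 = r → f ≠ 0) := by
  rcases subsingleton_or_nontrivial B with hB | hB
  · refine ⟨0, .zero B, Subsingleton.elim _ _, ?_, fun h => ?_⟩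
    · convert tendsto_const_nhds
    · rw [Subsingleton.elim b 0] at h
      simp at h
      exact absurd h hr.ne
  set a : B := r⁻¹ • (b * star b) with ha
  have hac : (r : ℂ)⁻¹ • (b * star b) = a := by
    rw [ha, ← Complex.ofReal_inv, Complex.coe_smul]
  have hsa : IsSelfAdjoint a := (IsSelfAdjoint.all r⁻¹).smul (IsSelfAdjoint.mul_star_self b)
  have hn : ‖a‖ = r⁻¹ * ‖b‖ ^ 2 := by
    rw [ha, norm_smul, CStarRing.norm_self_mul_star, Real.norm_of_nonneg (inv_nonneg.2 hr.le), sq]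
  have hn1 : ‖a‖ ≤ 1 := by
    rw [hn]; calc _ ≤ r⁻¹ * r := by gcongr
      _ = 1 := inv_mul_cancel₀ hr.ne'
  have hfin : (spectrum ℝ a).Finite := finite_real_spectrum_of_finiteDimensional _
  have hc : ∀ f : ℝ → ℝ, ContinuousOn f (spectrum ℝ a) := fun f => hfin.continuousOn f
  have hspec : ∀ t ∈ spectrum ℝ a, 0 ≤ t ∧ t ≤ 1 := by
    intro t ht
    refine ⟨?_, ?_⟩
    · have : a = star ((Real.sqrt r⁻¹) • star b) * ((Real.sqrt r⁻¹) • star b) := by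
        rw [star_smul, star_star, smul_mul_smul_comm, star_trivial,
          Real.mul_self_sqrt (inv_nonneg.2 hr.le)]
      rw [this] at ht
      exact spectrum_star_mul_self_nonneg t ht
    · exact (le_abs_self t).trans ((spectrum.norm_le_norm_of_mem ht).trans hn1)
  let g : ℝ → ℝ := fun t => if t = 1 then 1 else 0
  have hlim : Tendsto (fun n : ℕ => a ^ n) atTop (𝓝 (cfc g a)) := by
    have h1 : (fun n : ℕ => a ^ n) = fun n : ℕ => cfc (fun t : ℝ => t ^ n) a := by
      funext n
      rw [cfc_pow_id (R := ℝ) a n hsa]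
    rw [h1]
    refine tendsto_cfc_fun (hfin.tendstoUniformlyOn_of_pointwise ?_) (.of_forall fun n => hc _)
    intro t ht
    by_cases h : t = 1
    · simp [g, h]
    · simp only [g, h, if_false]
      exact tendsto_pow_atTop_nhds_zero_of_lt_one (hspec t ht).1
        (lt_of_le_of_ne (hspec t ht).2 h)
  refine ⟨cfc g a, ⟨?_, cfc_predicate _ _⟩, ?_, by rw [hac]; exact hlim, ?_⟩
  · unfold IsIdempotentElem
    rw [← cfc_mul _ _ _ (hc _) (hc _)]
    congr 1
    funext t
    simp only [g]
    split_ifs <;> simp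
  · have h1 : a * cfc g a = cfc g a := by
      conv_lhs =>
        arg 1
        rw [← cfc_id' ℝ a hsa]
      rw [← cfc_mul _ _ _ (hc _) (hc _)]
      congr 1
      funext t
      simp only [g]
      split_ifs with h <;> simp [h]
    rw [← hac, smul_mul_assoc, inv_smul_eq_iff₀ (by exact_mod_cast hr.ne')] at h1
    rw [hac] at h1
    exact h1
  · intro h h0
    rw [h0] at hlim
    -- For self-adjoint `a` the C*-identity gives `‖a ^ 2 ^ n‖ = ‖a‖ ^ 2 ^ n = 1`, so the powers
    -- cannot tend to `0`.
    have h1 : Tendsto (fun n : ℕ => ‖a ^ (2 ^ n)‖) atTop (𝓝 0) := by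
      have := (hlim.comp (tendsto_pow_atTop_atTop_of_one_lt (one_lt_two (α := ℕ)))).norm
      simpa using this
    have h2 : ∀ n : ℕ, ‖a ^ (2 ^ n)‖ = 1 := by
      intro n
      have := congrArg NNReal.toReal (hsa.nnnorm_pow_two_pow n)
      simp only [coe_nnnorm, NNReal.coe_pow] at this
      rw [this, hn, h, inv_mul_cancel₀ hr.ne', one_pow]
    simp only [h2] at h1
    exact one_ne_zero (tendsto_nhds_unique tendsto_const_nhds h1)

theorem exists_star_mul_self_eq_sub_mul_star {B : Type*} [CStarAlgebra B] (b : B) {r : ℝ}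
    (h : ‖b‖ ^ 2 ≤ r) : ∃ s : B, star s * s = (r : ℂ) • 1 - b * star b := by
  let _ := CStarAlgebra.spectralOrder B
  have := CStarAlgebra.spectralOrderedRing B
  have h1 : b * star b ≤ algebraMap ℝ B (‖b‖ ^ 2) := CStarAlgebra.mul_star_le_algebraMap_norm_sq
  have h2 : algebraMap ℝ B (‖b‖ ^ 2) ≤ algebraMap ℝ B r := algebraMap_mono B h
  obtain ⟨s, hs⟩ := CStarAlgebra.nonneg_iff_eq_star_mul_self.1 (sub_nonneg.2 (h1.trans h2))
  refine ⟨s, hs.symm.trans ?_⟩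
  rw [Algebra.algebraMap_eq_smul_one, Complex.coe_smul]

theorem exists_star_mul_self_eq_sub_add_star {B : Type*} [CStarAlgebra B] (b : B) :
    ∃ s : B, star s * s = (2 * ‖b‖ : ℂ) • 1 - (b + star b) := by
  let _ := CStarAlgebra.spectralOrder B
  have := CStarAlgebra.spectralOrderedRing B
  have h1 : b + star b ≤ algebraMap ℝ B ‖b + star b‖ :=
    (IsSelfAdjoint.add_star_self b).le_algebraMap_norm_self
  have h3 : ‖b + star b‖ ≤ 2 * ‖b‖ := by
    refine (norm_add_le _ _).trans ?_
    rw [norm_star, two_mul]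
  have h2 : algebraMap ℝ B ‖b + star b‖ ≤ algebraMap ℝ B (2 * ‖b‖) := algebraMap_mono B h3
  obtain ⟨s, hs⟩ := CStarAlgebra.nonneg_iff_eq_star_mul_self.1 (sub_nonneg.2 (h1.trans h2))
  refine ⟨s, hs.symm.trans ?_⟩
  rw [Algebra.algebraMap_eq_smul_one, ← Complex.coe_smul]
  norm_num

namespace IsFaithfulTrace

variable {C : Type*} [Ring C] [StarRing C] [Algebra ℂ C] {t : C →ₗ[ℂ] ℂ}

/-- Polarization: positivity at `1 + x` and `1 + i x` makes the imaginary parts of `t (x + star x)`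
and `t (i (x - star x))` vanish. -/
theorem map_star [StarModule ℂ C] (ht : IsFaithfulTrace t) (x : C) : t (star x) = star (t x) := by
  have h (y : C) : (t (star y * y)).im = 0 := (Complex.nonneg_iff.1 (ht.nonneg y)).2.symm
  have h1 := h (1 + x)
  have h2 := h (1 + Complex.I • x)
  have h0 := h 1
  have hx := h x
  simp only [star_add, star_one, add_mul, mul_add, one_mul, mul_one, map_add, star_smul,
    smul_mul_assoc, mul_smul_comm, map_smul, smul_eq_mul, Complex.add_im,
    Complex.mul_im, Complex.mul_re, Complex.I_re, Complex.I_im, RCLike.star_def,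
    Complex.conj_I, Complex.neg_re, Complex.neg_im, neg_mul] at h0 h1 h2 hx
  apply Complex.ext
  · simp only [RCLike.star_def, Complex.conj_re]
    linarith
  · simp only [RCLike.star_def, Complex.conj_im]
    linarith

theorem mul_star_self_eq_zero (ht : IsFaithfulTrace t) {x : C} (h : t (x * star x) = 0) :
    x = 0 := by
  rw [ht.trace] at h
  exact ht.faithful x h

end IsFaithfulTrace

end CStar

/-! ### Characters and minimal projections of a commutative algebra. -/

section Commutative

variable {A : Type*} [CommCStarAlgebra A] [PartialOrder A] [StarOrderedRing A]

theorem CommCStarAlgebra.mul_nonneg {x y : A} (hx : 0 ≤ x) (hy : 0 ≤ y) : 0 ≤ x * y :=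
  (Commute.all x y).mul_nonneg hx hy

theorem CommCStarAlgebra.complex_smul_nonneg {c : ℂ} {x : A} (hc : 0 ≤ c) (hx : 0 ≤ x) :
    0 ≤ c • x := by
  obtain ⟨h1, h2⟩ := Complex.nonneg_iff.1 hc
  obtain ⟨r, rfl⟩ : ∃ r : ℝ, c = r := ⟨c.re, Complex.ext rfl h2.symm⟩
  rw [Complex.coe_smul]
  exact smul_nonneg (by simpa using h1) hx

theorem CommCStarAlgebra.mul_le_of_le_smul_one {c : ℂ} {w x : A} (hw : 0 ≤ w)
    (h : x ≤ c • (1 : A)) : w * x ≤ c • w := by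
  have := CommCStarAlgebra.mul_nonneg hw (sub_nonneg.2 h)
  rwa [mul_sub, mul_smul_comm, mul_one, sub_nonneg] at this

theorem IsStarProjection.mul_eq_self_of_le {p x y : A} (hp : IsStarProjection p) (hx : 0 ≤ x)
    (hxy : x ≤ y) (h : p * y = y) : p * x = x := by
  have h1 := CommCStarAlgebra.mul_nonneg hp.one_sub_nonneg hx
  have h2 := CommCStarAlgebra.mul_nonneg hp.one_sub_nonneg (sub_nonneg.2 hxy)
  have h3 : (1 - p) * (y - x) = -((1 - p) * x) := by
    linear_combination (1 : A) * (-h)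
  rw [h3, neg_nonneg] at h2
  have := le_antisymm h2 h1
  rw [sub_mul, one_mul, sub_eq_zero] at this
  exact this.symm

theorem CommCStarAlgebra.ext_characters {A : Type*} [CommCStarAlgebra A] {a b : A}
    (h : ∀ χ : characterSpace ℂ A, χ a = χ b) : a = b :=
  (gelfandStarTransform A).injective (ContinuousMap.ext h)

/-- Distinct characters are linearly independent (Dedekind) in a finite-dimensional dual. -/
instance {A : Type*} [CommCStarAlgebra A] [FiniteDimensional ℂ A] :
    Finite (characterSpace ℂ A) := by
  have h1 : LinearIndependent ℂ fun χ : characterSpace ℂ A => (fun a => χ a : A → ℂ) :=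
    (linearIndependent_monoidHom A ℂ).comp
      (fun χ : characterSpace ℂ A => ((CharacterSpace.toAlgHom χ : A →ₐ[ℂ] ℂ) : A →* ℂ))
      fun χ χ' h => by
        apply DFunLike.ext
        intro a
        exact DFunLike.congr_fun h a
  have h2 : LinearIndependent ℂ fun χ : characterSpace ℂ A =>
      ((CharacterSpace.toAlgHom χ).toLinearMap : Module.Dual ℂ A) :=
    LinearIndependent.of_comp (LinearMap.ltoFun ℂ A ℂ ℂ) h1
  exact h2.finite

theorem CommCStarAlgebra.nonneg_iff_characters {a : A} :
    0 ≤ a ↔ ∀ χ : characterSpace ℂ A, 0 ≤ χ a := by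
  rw [← map_le_map_iff (gelfandStarTransform A), map_zero, ContinuousMap.le_def]
  rfl

theorem exists_isMinimalProjection_character [FiniteDimensional ℂ A] (χ : characterSpace ℂ A) :
    ∃ p : A, IsMinimalProjection p ∧ χ p = 1 ∧ ∀ a, a * p = χ a • p := by
  classical
  let p : A := (gelfandStarTransform A).symm ⟨fun χ' => if χ' = χ then 1 else 0, by fun_prop⟩
  have hpa (χ' : characterSpace ℂ A) : χ' p = if χ' = χ then 1 else 0 :=
    DFunLike.congr_fun ((gelfandStarTransform A).apply_symm_apply
      ⟨fun χ' => if χ' = χ then 1 else 0, by fun_prop⟩) χ'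
  have hmul (a : A) : a * p = χ a • p := by
    refine CommCStarAlgebra.ext_characters fun χ' => ?_
    rw [map_mul, map_smul, hpa, smul_eq_mul]
    split_ifs with h <;> simp [h]
  have hχ : χ p = 1 := by rw [hpa, if_pos rfl]
  have hp : IsStarProjection p := by
    refine ⟨?_, ?_⟩
    · rw [IsIdempotentElem, hmul, hχ, one_smul]
    · refine CommCStarAlgebra.ext_characters fun χ' => ?_
      rw [map_star, hpa]
      split_ifs <;> simp
  refine ⟨p, ⟨hp, fun h => ?_, fun q hq hqp => ?_⟩, hχ, hmul⟩
  · rw [h, map_zero] at hχ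
    exact zero_ne_one hχ
  · have h1 : q = χ q • p := by
      rw [← hmul, mul_comm]
      exact (hp.mul_eq_self_of_le hq.nonneg hqp hp.isIdempotentElem).symm
    have h2 : χ q * χ q = χ q := by rw [← map_mul, hq.isIdempotentElem.eq]
    rcases IsIdempotentElem.iff_eq_zero_or_one.1 h2 with h | h
    · left; rw [h1, h, zero_smul]
    · right; rw [h1, h, one_smul]

theorem exists_character_of_isMinimalProjection [FiniteDimensional ℂ A] {p : A}
    (hp : IsMinimalProjection p) : ∃ χ : characterSpace ℂ A, ∀ a, a * p = χ a • p := by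
  obtain ⟨χ, hχ⟩ : ∃ χ : characterSpace ℂ A, χ p ≠ 0 := by
    by_contra! h
    exact hp.2.1 (CommCStarAlgebra.ext_characters fun χ => by rw [h, map_zero])
  obtain ⟨q, hq, hq1, hqm⟩ := exists_isMinimalProjection_character χ
  have h2 : χ p * χ p = χ p := by rw [← map_mul, hp.1.isIdempotentElem.eq]
  have h3 := (IsIdempotentElem.iff_eq_zero_or_one.1 h2).resolve_left hχ
  have h4 : p * q = q := by rw [hqm, h3, one_smul]
  rcases hp.2.2 q hq.1 (hq.1.le_of_mul_eq_right hp.1 h4) with h | h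
  · exact absurd h hq.2.1
  · exact ⟨χ, h ▸ hqm⟩

theorem exists_pointProjections [FiniteDimensional ℂ A] [Fintype (characterSpace ℂ A)] :
    ∃ p : characterSpace ℂ A → A, (∀ χ, IsMinimalProjection (p χ)) ∧
      (∀ χ a, a * p χ = χ a • p χ) ∧ ∀ a, a = ∑ χ, χ a • p χ := by
  choose p hp hp1 hpm using exists_isMinimalProjection_character (A := A)
  refine ⟨p, hp, hpm, fun a => CommCStarAlgebra.ext_characters fun χ => ?_⟩
  rw [map_sum, Finset.sum_eq_single χ]
  · rw [map_smul, hp1, smul_eq_mul, mul_one]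
  · intro χ' _ hne
    rw [map_smul, smul_eq_mul]
    by_cases h : χ (p χ') = 0
    · rw [h, mul_zero]
    · refine absurd (DFunLike.ext _ _ fun a => ?_) hne
      have := congrArg χ (hpm χ' a)
      rw [map_mul, map_smul, smul_eq_mul] at this
      exact (mul_right_cancel₀ h this).symm
  · exact fun h => absurd (Finset.mem_univ χ) h

end Commutative

/-! ### Convolution, modular conjugation and reciprocity. -/

namespace FusionBialgebra

variable {A B : Type*} [CommCStarAlgebra A] [PartialOrder A] [StarOrderedRing A]
  [FiniteDimensional ℂ A] [CStarAlgebra B] [FiniteDimensional ℂ B] (𝓕 : FusionBialgebra A B)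

theorem fourier_conv (x y : A) : 𝓕.fourier (𝓕.conv x y) = 𝓕.fourier x * 𝓕.fourier y :=
  𝓕.fourier.apply_symm_apply _

theorem conv_add (x y z : A) : 𝓕.conv x (y + z) = 𝓕.conv x y + 𝓕.conv x z := by
  simp [conv, mul_add]

theorem add_conv (x y z : A) : 𝓕.conv (x + y) z = 𝓕.conv x z + 𝓕.conv y z := by
  simp [conv, add_mul]

theorem conv_sub (x y z : A) : 𝓕.conv x (y - z) = 𝓕.conv x y - 𝓕.conv x z := by
  simp [conv, mul_sub]

theorem sub_conv (x y z : A) : 𝓕.conv (x - y) z = 𝓕.conv x z - 𝓕.conv y z := by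
  simp [conv, sub_mul]

theorem conv_smul (c : ℂ) (x y : A) : 𝓕.conv x (c • y) = c • 𝓕.conv x y := by
  simp [conv]

theorem smul_conv (c : ℂ) (x y : A) : 𝓕.conv (c • x) y = c • 𝓕.conv x y := by
  simp [conv]

theorem conv_zero (x : A) : 𝓕.conv x 0 = 0 := by simp [conv]

theorem zero_conv (x : A) : 𝓕.conv 0 x = 0 := by simp [conv]

theorem conv_assoc (x y z : A) : 𝓕.conv (𝓕.conv x y) z = 𝓕.conv x (𝓕.conv y z) := by
  simp [conv, mul_assoc]

theorem conv_nonneg {x y : A} (hx : 0 ≤ x) (hy : 0 ≤ y) : 0 ≤ 𝓕.conv x y := 𝓕.schur x y hx hy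

theorem conv_le_conv_left {x y z : A} (hz : 0 ≤ z) (h : x ≤ y) : 𝓕.conv x z ≤ 𝓕.conv y z := by
  rw [← sub_nonneg, ← sub_conv]
  exact 𝓕.conv_nonneg (sub_nonneg.2 h) hz

theorem conv_le_conv_right {x y z : A} (hz : 0 ≤ z) (h : x ≤ y) : 𝓕.conv z x ≤ 𝓕.conv z y := by
  rw [← sub_nonneg, ← conv_sub]
  exact 𝓕.conv_nonneg hz (sub_nonneg.2 h)

/-- Positive elements span `A`, and a convolution of positive elements is positive, hence
self-adjoint. -/
theorem star_conv (x y : A) : star (𝓕.conv x y) = 𝓕.conv (star x) (star y) := by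
  have hx : x ∈ Submodule.span ℂ {a : A | 0 ≤ a} := by
    rw [CStarAlgebra.span_nonneg]; trivial
  have hy : y ∈ Submodule.span ℂ {a : A | 0 ≤ a} := by
    rw [CStarAlgebra.span_nonneg]; trivial
  induction hx using Submodule.span_induction with
  | zero => simp [zero_conv]
  | add x x' _ _ h h' => simp [add_conv, h, h']
  | smul c x _ h => simp [smul_conv, h]
  | mem x hx =>
    induction hy using Submodule.span_induction with
    | zero => simp [conv_zero]
    | add y y' _ _ h h' => simp [conv_add, h, h']
    | smul c y _ h => simp [conv_smul, h]
    | mem y hy =>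
      have hx' : 0 ≤ x := hx
      have hy' : 0 ≤ y := hy
      rw [(𝓕.conv_nonneg hx' hy').star_eq, hx'.star_eq, hy'.star_eq]

/-- The modular conjugation. -/
noncomputable def J (x : A) : A := 𝓕.fourier.symm (star (𝓕.fourier x))

theorem fourier_J (x : A) : 𝓕.fourier (𝓕.J x) = star (𝓕.fourier x) :=
  𝓕.fourier.apply_symm_apply _

theorem J_J (x : A) : 𝓕.J (𝓕.J x) = x := by simp [J]

theorem J_mul (x y : A) : 𝓕.J (x * y) = 𝓕.J x * 𝓕.J y := 𝓕.modular_mul x y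

theorem J_star (x : A) : 𝓕.J (star x) = star (𝓕.J x) := 𝓕.modular_star x

theorem J_one : 𝓕.J 1 = 1 := by
  have h := 𝓕.J_mul 1 (𝓕.J 1)
  rw [one_mul, J_J, mul_one] at h
  exact h.symm

theorem J_zero : 𝓕.J 0 = 0 := by simp [J]

theorem J_nonneg {x : A} (hx : 0 ≤ x) : 0 ≤ 𝓕.J x := by
  obtain ⟨s, rfl⟩ := CStarAlgebra.nonneg_iff_eq_star_mul_self.1 hx
  rw [J_mul, J_star]
  exact star_mul_self_nonneg _

theorem d_nonneg {x : A} (hx : 0 ≤ x) : 0 ≤ 𝓕.d x := by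
  obtain ⟨s, rfl⟩ := CStarAlgebra.nonneg_iff_eq_star_mul_self.1 hx
  exact 𝓕.d_trace.nonneg s

theorem d_mono {x y : A} (h : x ≤ y) : 𝓕.d x ≤ 𝓕.d y := by
  rw [← sub_nonneg, ← map_sub]
  exact 𝓕.d_nonneg (sub_nonneg.2 h)

theorem eq_zero_of_d_eq_zero {x : A} (hx : 0 ≤ x) (h : 𝓕.d x = 0) : x = 0 := by
  obtain ⟨s, rfl⟩ := CStarAlgebra.nonneg_iff_eq_star_mul_self.1 hx
  rw [𝓕.d_trace.faithful s h, mul_zero]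

theorem eq_of_le_of_d_le {x y : A} (h : x ≤ y) (hd : 𝓕.d y ≤ 𝓕.d x) : x = y := by
  have := 𝓕.eq_zero_of_d_eq_zero (sub_nonneg.2 h)
    (by rw [map_sub, sub_eq_zero]; exact le_antisymm hd (𝓕.d_mono h))
  exact (sub_eq_zero.1 this).symm

theorem d_pos {x : A} (hx : 0 ≤ x) (h : x ≠ 0) : 0 < 𝓕.d x :=
  lt_of_le_of_ne (𝓕.d_nonneg hx) fun h0 => h (𝓕.eq_zero_of_d_eq_zero hx h0.symm)

theorem d_mul {x : A} (hx : IsSelfAdjoint x) (y : A) :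
    𝓕.d (x * y) = 𝓕.τ (star (𝓕.fourier x) * 𝓕.fourier y) := by
  rw [𝓕.plancherel, hx.star_eq]

/-- Frobenius reciprocity, from the Plancherel formula and the trace property of `τ`. -/
theorem d_mul_conv {x z : A} (hx : 0 ≤ x) (hz : 0 ≤ z) (y : A) :
    𝓕.d (x * 𝓕.conv y z) = 𝓕.d (𝓕.conv x (𝓕.J z) * y) := by
  rw [𝓕.d_mul hx.isSelfAdjoint, 𝓕.d_mul (𝓕.conv_nonneg hx (𝓕.J_nonneg hz)).isSelfAdjoint,
    fourier_conv, fourier_conv, fourier_J, star_mul, star_star, mul_assoc, ← mul_assoc,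
    𝓕.τ_trace.trace, ← mul_assoc]

/-! ### Perron-Frobenius theory of the convolution. -/

variable {𝓕}

/-- The normalized convolution unit `e` is a minimal projection, so `z * e` is a multiple of `e`.
Plancherel identifies the coefficient as `τ (𝔉 z)`, once the dimension hypothesis fixes `d e = c⁻¹`.
-/
theorem exists_unit (hd : 𝓕.IsDimension) : ∃ (c : ℝ) (e : A), 0 < c ∧ IsStarProjection e ∧
    e ≠ 0 ∧ 𝓕.fourier e = (c : ℂ)⁻¹ • 1 ∧ ∀ z, z * e = 𝓕.τ (𝓕.fourier z) • e := by
  obtain ⟨c, hc, e, he, h1⟩ := 𝓕.jones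
  have hc' : (c : ℂ) ≠ 0 := by exact_mod_cast hc.ne'
  have hfe : 𝓕.fourier e = (c : ℂ)⁻¹ • 1 := by
    rw [eq_inv_smul_iff₀ hc', ← map_smul, ← h1, LinearEquiv.apply_symm_apply]
  have : Nontrivial B := ⟨𝓕.fourier e, 0, fun h => he.2.1 (by simpa using h)⟩
  have hde : 𝓕.d e = (c : ℂ)⁻¹ := by
    rw [hd e he, hfe, norm_smul, norm_one, mul_one, norm_inv, Complex.norm_real,
      Real.norm_of_nonneg hc.le, Complex.ofReal_inv]
  obtain ⟨χ, hχ⟩ := exists_character_of_isMinimalProjection he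
  refine ⟨c, e, hc, he.1, he.2.1, hfe, fun z => ?_⟩
  have h2 := 𝓕.d_mul he.1.isSelfAdjoint z
  rw [mul_comm, hχ, map_smul, hde, hfe, star_smul, star_one, smul_mul_assoc, one_mul, map_smul,
    smul_eq_mul, smul_eq_mul, star_inv₀, Complex.star_def, Complex.conj_ofReal, mul_comm] at h2
  rw [hχ, mul_left_cancel₀ (inv_ne_zero hc') h2]

theorem conv_ne_zero (hd : 𝓕.IsDimension) {x y : A} (hx : 0 ≤ x) (hy : 0 ≤ y) (hx0 : x ≠ 0)
    (hy0 : y ≠ 0) : 𝓕.conv x y ≠ 0 := by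
  intro h
  obtain ⟨c, e, -, -, he, -, hz⟩ := 𝓕.exists_unit hd
  have hv : 0 ≤ 𝓕.conv (𝓕.J x) x := 𝓕.conv_nonneg (𝓕.J_nonneg hx) hx
  have hw : 0 ≤ 𝓕.conv y (𝓕.J y) := 𝓕.conv_nonneg hy (𝓕.J_nonneg hy)
  -- With `a = 𝔉 x` and `b = 𝔉 y`, the `d`-value of this positive product is `τ (a^* a b b^*) = 0`.
  -- Its coefficient at `e` is `τ (a^* a) τ (b b^*)`, so one factor vanishes.
  have h0 : 𝓕.conv (𝓕.J x) x * 𝓕.conv y (𝓕.J y) = 0 := by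
    refine 𝓕.eq_zero_of_d_eq_zero (CommCStarAlgebra.mul_nonneg hv hw) ?_
    replace h := congrArg 𝓕.fourier h
    rw [fourier_conv, map_zero] at h
    rw [𝓕.d_mul hv.isSelfAdjoint, fourier_conv, fourier_conv, fourier_J, star_mul, star_star,
      mul_assoc, ← mul_assoc (𝓕.fourier x), h, zero_mul, mul_zero, map_zero]
  have h1 : 𝓕.conv (𝓕.J x) x * 𝓕.conv y (𝓕.J y) * e = 0 := by rw [h0, zero_mul]
  rw [mul_assoc, hz, mul_smul_comm, hz, smul_smul, smul_eq_zero, mul_eq_zero, or_iff_left he,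
    fourier_conv, fourier_conv, fourier_J, fourier_J] at h1
  have h2 (z : A) : 𝓕.fourier z = 0 → z = 0 := fun h => by simpa using h
  rcases h1 with h1 | h1
  · exact hy0 (h2 _ (𝓕.τ_trace.mul_star_self_eq_zero h1))
  · exact hx0 (h2 _ (𝓕.τ_trace.faithful _ h1))

theorem nonneg_of_tendsto_pow {b f : B} {s : ℂ} (hs : 0 ≤ s) (hb : 0 ≤ 𝓕.fourier.symm b)
    (h : Tendsto (fun n : ℕ => (s • (b * star b)) ^ n) atTop (𝓝 f)) :
    0 ≤ 𝓕.fourier.symm f := by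
  have hcont : Continuous 𝓕.fourier.symm :=
    𝓕.fourier.symm.toLinearMap.continuous_of_finiteDimensional
  refine CStarAlgebra.isClosed_nonneg.mem_of_tendsto ((hcont.tendsto f).comp h)
    (.of_forall fun n => ?_)
  simp only [Function.comp_apply, Set.mem_ofPred_eq]
  induction n with
  | zero =>
    -- The zeroth power is `1`, positive in `A` by the Jones projection axiom.
    obtain ⟨c, hc, e, he, h1⟩ := 𝓕.jones
    rw [pow_zero, h1]
    exact CommCStarAlgebra.complex_smul_nonneg (by exact_mod_cast hc.le) he.1.nonneg
  | succ n ih =>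
    rw [pow_succ, mul_smul_comm, map_smul]
    refine CommCStarAlgebra.complex_smul_nonneg hs ?_
    have h1 := 𝓕.schur _ _ hb (𝓕.J_nonneg hb)
    have h2 := 𝓕.schur _ _ ih h1
    simpa only [fourier_J, LinearEquiv.apply_symm_apply] using h2

theorem character_one_conv_pos (hd : 𝓕.IsDimension) {y : A} (hy : 0 ≤ y) (hy0 : y ≠ 0)
    (χ : characterSpace ℂ A) : 0 < χ (𝓕.conv 1 y) := by
  obtain ⟨p, hp, -, hpm⟩ := exists_isMinimalProjection_character χ
  have hp0 := hp.1.nonneg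
  have h1 : 0 < 𝓕.d (p * 𝓕.conv 1 y) := by
    rw [𝓕.d_mul_conv hp0 hy, mul_one]
    have hJ : 𝓕.J y ≠ 0 := fun h => hy0 (by rw [← 𝓕.J_J y, h, J_zero])
    exact 𝓕.d_pos (𝓕.conv_nonneg hp0 (𝓕.J_nonneg hy))
      (conv_ne_zero hd hp0 (𝓕.J_nonneg hy) hp.2.1 hJ)
  refine lt_of_le_of_ne (CommCStarAlgebra.nonneg_iff_characters.1
    (𝓕.conv_nonneg zero_le_one hy) χ) fun h => ?_
  rw [mul_comm, hpm, ← h, zero_smul, map_zero] at h1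
  exact lt_irrefl _ h1

theorem character_pos_of_one_conv_one_conv (hd : 𝓕.IsDimension) {y : A} (hy : 0 ≤ y)
    (hy0 : y ≠ 0) {r : ℂ} (h : 𝓕.conv 1 (𝓕.conv 1 y) = r • y)
    (χ : characterSpace ℂ A) : 0 < χ y := by
  have : Nontrivial A := ⟨y, 0, hy0⟩
  have h1 := character_one_conv_pos hd (𝓕.conv_nonneg zero_le_one hy)
    (conv_ne_zero hd zero_le_one hy one_ne_zero hy0) χ
  rw [h, map_smul, smul_eq_mul] at h1
  refine lt_of_le_of_ne (CommCStarAlgebra.nonneg_iff_characters.1 hy χ) fun h0 => ?_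
  rw [← h0, mul_zero] at h1
  exact lt_irrefl _ h1

/-- Uniqueness of the Perron-Frobenius eigenvector of the convolution with `1`. -/
theorem exists_smul_eq_of_one_conv_one_conv (hd : 𝓕.IsDimension) {x y : A} (hx : 0 ≤ x)
    (hx0 : x ≠ 0) (hy : 0 ≤ y) {r : ℂ}
    (hrx : 𝓕.conv 1 (𝓕.conv 1 x) = r • x) (hry : 𝓕.conv 1 (𝓕.conv 1 y) = r • y) :
    ∃ t : ℝ, 0 ≤ t ∧ y = (t : ℂ) • x := by
  have : Nontrivial A := ⟨x, 0, hx0⟩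
  have hre {a : A} (ha : 0 ≤ a) (χ : characterSpace ℂ A) : 0 ≤ (χ a).re ∧ χ a = (χ a).re := by
    have h := Complex.nonneg_iff.1 (CommCStarAlgebra.nonneg_iff_characters.1 ha χ)
    exact ⟨h.1, Complex.ext rfl h.2.symm⟩
  have hxpos (χ : characterSpace ℂ A) : 0 < (χ x).re :=
    (Complex.pos_iff.1 (character_pos_of_one_conv_one_conv hd hx hx0 hrx χ)).1
  -- Subtracting the least ratio times `x` leaves a nonnegative eigenvector vanishing at `χ`. A
  -- nonzero one would be strictly positive there.
  obtain ⟨χ, hχ⟩ := Finite.exists_min fun χ : characterSpace ℂ A => (χ y).re / (χ x).re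
  refine ⟨(χ y).re / (χ x).re, div_nonneg (hre hy χ).1 (hxpos χ).le, ?_⟩
  set t := (χ y).re / (χ x).re
  by_contra hne
  have h1 : 0 ≤ y - (t : ℂ) • x := by
    refine CommCStarAlgebra.nonneg_iff_characters.2 fun χ' => ?_
    rw [map_sub, map_smul, smul_eq_mul, (hre hx χ').2, (hre hy χ').2, ← Complex.ofReal_mul,
      ← Complex.ofReal_sub, Complex.zero_le_real, sub_nonneg]
    exact (le_div_iff₀ (hxpos χ')).1 (hχ χ')
  have h2 := character_pos_of_one_conv_one_conv hd h1 (sub_ne_zero.2 hne)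
    (by rw [conv_sub, conv_sub, conv_smul, conv_smul, hrx, hry, smul_sub, smul_comm]) χ
  rw [map_sub, map_smul, smul_eq_mul, (hre hx χ).2, (hre hy χ).2, ← Complex.ofReal_mul,
    div_mul_cancel₀ _ (hxpos χ).ne', sub_self] at h2
  exact lt_irrefl _ h2

/-- The Perron-Frobenius theorem: `d ∘ 𝔉⁻¹` is the character of a rank one central projection. -/
theorem exists_projection_mul_fourier [Nontrivial A] (hd : 𝓕.IsDimension) :
    ∃ f : B, f ≠ 0 ∧ IsStarProjection f ∧ ∀ x, f * 𝓕.fourier x = 𝓕.d x • f := by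
  have hu0 : 𝓕.fourier 1 ≠ 0 := by simp
  have hus : star (𝓕.fourier 1) = 𝓕.fourier 1 := by rw [← fourier_J, J_one]
  have hr : 0 < ‖𝓕.fourier 1‖ ^ 2 := by positivity
  -- `f` projects onto the top eigenspace of `𝔉(1)²`. Every `f * 𝔉 x` with `x ≥ 0` is a positive
  -- Perron eigenvector, hence a multiple of `f`.
  obtain ⟨f, hf, hfu, hlim, hf0⟩ := exists_tendsto_pow_projection (𝓕.fourier 1) hr le_rfl
  replace hf0 := hf0 rfl
  have hG : 0 ≤ 𝓕.fourier.symm f :=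
    nonneg_of_tendsto_pow (inv_nonneg.2 (by exact_mod_cast hr.le)) (by simp) hlim
  have hG0 : 𝓕.fourier.symm f ≠ 0 := by simpa using hf0
  have hGr (x : B) : 𝓕.conv 1 (𝓕.conv 1 (𝓕.fourier.symm (f * x))) =
      ((‖𝓕.fourier 1‖ ^ 2 : ℝ) : ℂ) • 𝓕.fourier.symm (f * x) := by
    apply 𝓕.fourier.injective
    rw [fourier_conv, fourier_conv, map_smul, LinearEquiv.apply_symm_apply, ← mul_assoc,
      ← mul_assoc, ← smul_mul_assoc, ← hfu, hus]
  have key {x : A} (hx : 0 ≤ x) : ∃ t : ℝ, 0 ≤ t ∧ f * 𝓕.fourier x = (t : ℂ) • f := by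
    have h1 : 0 ≤ 𝓕.fourier.symm (f * 𝓕.fourier x) := by
      simpa using 𝓕.schur _ _ hG hx
    obtain ⟨t, ht, h⟩ := exists_smul_eq_of_one_conv_one_conv hd hG hG0 h1
      (by simpa using hGr 1) (hGr _)
    refine ⟨t, ht, ?_⟩
    rw [← 𝓕.fourier.apply_symm_apply (f * 𝓕.fourier x), h, map_smul,
      LinearEquiv.apply_symm_apply]
  refine ⟨f, hf0, hf, ?_⟩
  have hmin {p : A} (hp : IsMinimalProjection p) : f * 𝓕.fourier p = 𝓕.d p • f := by
    obtain ⟨t, ht, h⟩ := key hp.1.nonneg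
    obtain ⟨t', -, h'⟩ := key (𝓕.J_nonneg hp.1.nonneg)
    have htt : (t' : ℂ) = t := by
      have h1 : f * 𝓕.fourier p * f = (t : ℂ) • f := by
        rw [h, smul_mul_assoc, hf.isIdempotentElem.eq]
      have h2 : f * star (𝓕.fourier p) * f = (t' : ℂ) • f := by
        rw [← fourier_J, h', smul_mul_assoc, hf.isIdempotentElem.eq]
      have h3 := congrArg star h1
      rw [star_mul, star_mul, hf.isSelfAdjoint.star_eq, ← mul_assoc, h2, star_smul,
        hf.isSelfAdjoint.star_eq, Complex.star_def, Complex.conj_ofReal] at h3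
      exact smul_left_injective ℂ hf0 h3
    have hb0 : 𝓕.fourier p ≠ 0 := by simpa using hp.2.1
    have hb : 0 < ‖star (𝓕.fourier p)‖ ^ 2 := by rw [norm_star]; positivity
    -- To identify `t`, evaluate `f b^* b g` with `b = 𝔉 p` in two ways: as `t² f g` and as `‖b‖² f
    -- g`. Here `f g ≠ 0` because both factors come from the positive cone.
    obtain ⟨g, -, hg, hglim, hg0⟩ := exists_tendsto_pow_projection (star (𝓕.fourier p)) hb le_rfl
    have hH : 0 ≤ 𝓕.fourier.symm g :=
      nonneg_of_tendsto_pow (inv_nonneg.2 (by exact_mod_cast hb.le))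
        (𝓕.J_nonneg hp.1.nonneg) hglim
    have hfg : f * g ≠ 0 := by
      have := conv_ne_zero hd hG hH hG0 (by simpa using hg0 rfl)
      simpa [conv] using this
    have h1 := congrArg (f * ·) hg
    simp only [star_star, ← mul_assoc, mul_smul_comm] at h1
    rw [← fourier_J, h', smul_mul_assoc, h, htt, smul_smul, smul_mul_assoc] at h1
    have h2 := smul_left_injective ℂ hfg h1
    rw [fourier_J, norm_star] at h2
    norm_cast at h2
    have h3 : t = ‖𝓕.fourier p‖ := by
      rw [← sq] at h2
      exact (pow_left_inj₀ ht (norm_nonneg _) two_ne_zero).1 h2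
    rw [h, hd p hp, h3]
  intro x
  have := Fintype.ofFinite (characterSpace ℂ A)
  obtain ⟨p, hp, -, hsum⟩ := exists_pointProjections (A := A)
  rw [hsum x, map_sum, map_sum, Finset.mul_sum, Finset.sum_smul]
  refine Finset.sum_congr rfl fun χ _ => ?_
  rw [map_smul, map_smul, mul_smul_comm, hmin (hp χ), smul_assoc]

theorem d_conv (hd : 𝓕.IsDimension) (x y : A) : 𝓕.d (𝓕.conv x y) = 𝓕.d x * 𝓕.d y := by
  rcases subsingleton_or_nontrivial A with hA | hA
  · rw [Subsingleton.elim (𝓕.conv x y) 0, Subsingleton.elim x 0]; simp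
  obtain ⟨f, hf0, -, hf⟩ := exists_projection_mul_fourier hd
  apply smul_left_injective ℂ hf0
  simp only
  rw [← hf, fourier_conv, ← mul_assoc, hf, smul_mul_assoc, hf, smul_smul]

theorem τ_fourier_one_mul (x : A) : 𝓕.τ (𝓕.fourier 1 * 𝓕.fourier x) = 𝓕.d x := by
  rw [← one_mul x, 𝓕.d_mul (.one A), one_mul, ← fourier_J, J_one]

/-- The projection `f` carrying the character `d` equals `τ(f) 𝔉(1)`, since both have the same
`τ`-pairing with every `𝔉 x`. -/
theorem one_conv (hd : 𝓕.IsDimension) (x : A) : 𝓕.conv 1 x = 𝓕.d x • 1 := by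
  rcases subsingleton_or_nontrivial A with hA | hA
  · exact Subsingleton.elim _ _
  obtain ⟨f, hf0, -, hf⟩ := exists_projection_mul_fourier hd
  have h1 : f - 𝓕.τ f • 𝓕.fourier 1 = 0 := by
    apply 𝓕.τ_trace.mul_star_self_eq_zero
    rw [← 𝓕.fourier.apply_symm_apply (star (f - 𝓕.τ f • 𝓕.fourier 1)), sub_mul, map_sub, hf,
      smul_mul_assoc, map_smul, map_smul, τ_fourier_one_mul, smul_eq_mul, smul_eq_mul, mul_comm,
      sub_self]
  rw [sub_eq_zero] at h1
  have h2 : 𝓕.τ f ≠ 0 := fun h => hf0 (by rw [h1, h, zero_smul])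
  apply 𝓕.fourier.injective
  have h3 := hf x
  rw [h1, smul_mul_assoc, smul_comm] at h3
  rw [fourier_conv, map_smul]
  exact smul_right_injective B h2 h3

theorem d_J (x : A) : 𝓕.d (𝓕.J x) = star (𝓕.d x) := by
  rw [← τ_fourier_one_mul, ← τ_fourier_one_mul, ← 𝓕.τ_trace.map_star, star_mul, fourier_J,
    ← fourier_J 𝓕 1, J_one, 𝓕.τ_trace.trace]

theorem d_J_of_nonneg {x : A} (hx : 0 ≤ x) : 𝓕.d (𝓕.J x) = 𝓕.d x := by
  rw [d_J, (𝓕.d_nonneg hx).star_eq]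

/-- Triangle inequality over the minimal projections, where the bound is an equality by hypothesis.
-/
theorem norm_fourier_le (hd : 𝓕.IsDimension) {x : A} (hx : 0 ≤ x) :
    (‖𝓕.fourier x‖ : ℂ) ≤ 𝓕.d x := by
  have := Fintype.ofFinite (characterSpace ℂ A)
  obtain ⟨p, hp, -, hsum⟩ := exists_pointProjections (A := A)
  have h1 : ‖𝓕.fourier x‖ ≤ ∑ χ, ‖χ x‖ * ‖𝓕.fourier (p χ)‖ := by
    conv_lhs => rw [hsum x, map_sum]
    refine (norm_sum_le _ _).trans (Finset.sum_le_sum fun χ _ => ?_)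
    rw [map_smul, norm_smul]
  have h2 : 𝓕.d x = ((∑ χ, ‖χ x‖ * ‖𝓕.fourier (p χ)‖ : ℝ) : ℂ) := by
    conv_lhs => rw [hsum x, map_sum]
    rw [Complex.ofReal_sum]
    refine Finset.sum_congr rfl fun χ _ => ?_
    rw [map_smul, hd _ (hp χ), smul_eq_mul, Complex.ofReal_mul,
      ← Complex.eq_coe_norm_of_nonneg (CommCStarAlgebra.nonneg_iff_characters.1 hx χ)]
  rw [h2]
  exact_mod_cast h1

end FusionBialgebra

/-! ### Order bounds and range projections. -/

section Commutative

variable {A : Type*} [CommCStarAlgebra A] [PartialOrder A] [StarOrderedRing A]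

theorem CommCStarAlgebra.le_smul_of_mul_eq_self {w y : A} {c : ℂ} (hw : 0 ≤ w) (hy : y ≤ c • (1 : A))
    (h : w * y = y) : y ≤ c • w := by
  simpa only [h] using CommCStarAlgebra.mul_le_of_le_smul_one hw hy

theorem CommCStarAlgebra.isStarProjection_inv_smul {y : A} {c : ℂ} (hy : 0 ≤ y) (hc : 0 < c)
    (h : y * y = c • y) : IsStarProjection (c⁻¹ • y) := by
  refine ⟨?_, ?_⟩
  · rw [IsIdempotentElem, smul_mul_smul_comm, h, smul_smul, mul_assoc, inv_mul_cancel₀ hc.ne',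
      mul_one]
  · exact (CommCStarAlgebra.complex_smul_nonneg (inv_nonneg.2 hc.le) hy).isSelfAdjoint

end Commutative

section RangeProjection

variable {A : Type*} [CommCStarAlgebra A] [PartialOrder A] [StarOrderedRing A]
  [FiniteDimensional ℂ A]

theorem isStarProjection_rangeProjection (x : A) : IsStarProjection (rangeProjection x) :=
  (isLeast_rangeProjection x).1.1

theorem rangeProjection_mul_self (x : A) : rangeProjection x * x = x :=
  (isLeast_rangeProjection x).1.2

theorem rangeProjection_le {x p : A} (hp : IsStarProjection p) (h : p * x = x) :
    rangeProjection x ≤ p :=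
  (isLeast_rangeProjection x).2 ⟨hp, h⟩

theorem rangeProjection_smul_projection {p : A} (hp : IsStarProjection p) {c : ℂ} (hc : c ≠ 0) :
    rangeProjection (c • p) = p := by
  refine le_antisymm (rangeProjection_le hp ?_)
    (hp.le_of_mul_eq_right (isStarProjection_rangeProjection _) ?_)
  · rw [mul_smul_comm, hp.isIdempotentElem.eq]
  · have := rangeProjection_mul_self (c • p)
    rw [mul_smul_comm] at this
    exact smul_right_injective A hc this

theorem rangeProjection_projection {p : A} (hp : IsStarProjection p) : rangeProjection p = p := by
  simpa using rangeProjection_smul_projection hp one_ne_zero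

/-- The nonzero spectrum is finite, hence bounded away from `0`; the constant is the norm of the
partial inverse of `x * star x`. -/
theorem exists_rangeProjection_le_smul (x : A) :
    ∃ c : ℂ, 0 ≤ c ∧ rangeProjection x ≤ c • (x * star x) := by
  have hsa : IsSelfAdjoint (x * star x) := IsSelfAdjoint.mul_star_self x
  have hc : ∀ f : ℝ → ℝ, ContinuousOn f (spectrum ℝ (x * star x)) := fun f =>
    (finite_real_spectrum_of_finiteDimensional _).continuousOn f
  have h : rangeProjection x = (x * star x) * cfc (fun t : ℝ => t⁻¹) (x * star x) := by
    conv_rhs =>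
      arg 1
      rw [← cfc_id' ℝ (x * star x) hsa]
    unfold rangeProjection
    rw [← cfc_mul _ _ _ (hc _) (hc _)]
    congr 1
    funext t
    split_ifs with h <;> simp [h]
  have hv : IsSelfAdjoint (cfc (fun t : ℝ => t⁻¹) (x * star x)) := cfc_predicate _ _
  refine ⟨(‖cfc (fun t : ℝ => t⁻¹) (x * star x)‖ : ℝ), by exact_mod_cast norm_nonneg _, ?_⟩
  rw [h]
  refine CommCStarAlgebra.mul_le_of_le_smul_one (mul_star_self_nonneg x) ?_
  rw [Complex.coe_smul, ← Algebra.algebraMap_eq_smul_one]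
  exact hv.le_algebraMap_norm_self

end RangeProjection

/-! ### Support estimates and the equality case. -/

namespace FusionBialgebra

variable {A B : Type*} [CommCStarAlgebra A] [PartialOrder A] [StarOrderedRing A]
  [FiniteDimensional ℂ A] [CStarAlgebra B] [FiniteDimensional ℂ B] {𝓕 : FusionBialgebra A B}

theorem supp_projection {p : A} (hp : IsStarProjection p) : 𝓕.supp p = 𝓕.d p := by
  rw [supp, rangeProjection_projection hp]

theorem conv_le_smul_one (hd : 𝓕.IsDimension) {x y : A} (hx : x ≤ 1) (hy : 0 ≤ y) :
    𝓕.conv x y ≤ 𝓕.d y • 1 :=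
  (𝓕.conv_le_conv_left hy hx).trans_eq (one_conv hd y)

theorem conv_le_smul (hd : 𝓕.IsDimension) {x y w : A} (hx : x ≤ 1) (hy : 0 ≤ y) (hw : 0 ≤ w)
    (h : w * 𝓕.conv x y = 𝓕.conv x y) : 𝓕.conv x y ≤ 𝓕.d y • w :=
  CommCStarAlgebra.le_smul_of_mul_eq_self hw (conv_le_smul_one hd hx hy) h

theorem d_le_of_mul_conv_eq_self (hd : 𝓕.IsDimension) {x y w : A} (hx : x ≤ 1) (hy : 0 ≤ y)
    (hy0 : y ≠ 0) (hw : 0 ≤ w) (h : w * 𝓕.conv x y = 𝓕.conv x y) : 𝓕.d x ≤ 𝓕.d w := by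
  have h1 := 𝓕.d_mono (conv_le_smul hd hx hy hw h)
  rw [d_conv hd, map_smul, smul_eq_mul, mul_comm] at h1
  exact le_of_mul_le_mul_left h1 (𝓕.d_pos hy hy0)

theorem conv_eq_smul_of_d_le (hd : 𝓕.IsDimension) {x y w : A} (hx : x ≤ 1) (hy : 0 ≤ y)
    (hw : 0 ≤ w) (h : w * 𝓕.conv x y = 𝓕.conv x y) (hle : 𝓕.d w ≤ 𝓕.d x) :
    𝓕.conv x y = 𝓕.d y • w := by
  refine 𝓕.eq_of_le_of_d_le (conv_le_smul hd hx hy hw h) ?_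
  rw [d_conv hd, map_smul, smul_eq_mul, mul_comm]
  exact mul_le_mul_of_nonneg_right hle (𝓕.d_nonneg hy)

/-- An element bounded by `c` with `d (y * y) = c * d y` is `c` times a projection. -/
theorem mul_self_eq_smul_of_le {y : A} {c : ℂ} (hy : 0 ≤ y) (h : y ≤ c • (1 : A))
    (hdy : 𝓕.d (y * y) = c * 𝓕.d y) : y * y = c • y := by
  refine 𝓕.eq_of_le_of_d_le (CommCStarAlgebra.mul_le_of_le_smul_one hy h) ?_
  rw [hdy, map_smul, smul_eq_mul]

theorem supp_conv_eq_iff (hd : 𝓕.IsDimension) {P Q : A} (hP : IsStarProjection P)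
    (hQ : IsStarProjection Q) (hQ0 : Q ≠ 0) :
    𝓕.supp (𝓕.conv P Q) = 𝓕.supp P ↔ IsStarProjection ((𝓕.supp Q)⁻¹ • 𝓕.conv P Q) := by
  have hdQ : 0 < 𝓕.d Q := 𝓕.d_pos hQ.nonneg hQ0
  rw [supp_projection hP, supp_projection hQ]
  refine ⟨fun h => ?_, fun h => ?_⟩
  · rw [conv_eq_smul_of_d_le hd hP.le_one hQ.nonneg (isStarProjection_rangeProjection _).nonneg
      (rangeProjection_mul_self _) h.le, smul_smul, inv_mul_cancel₀ hdQ.ne', one_smul]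
    exact isStarProjection_rangeProjection _
  · have h1 : 𝓕.conv P Q = 𝓕.d Q • ((𝓕.d Q)⁻¹ • 𝓕.conv P Q) := by
      rw [smul_smul, mul_inv_cancel₀ hdQ.ne', one_smul]
    rw [supp]
    conv_lhs => rw [h1]
    rw [rangeProjection_smul_projection h hdQ.ne', map_smul, d_conv hd, smul_eq_mul, mul_comm,
      mul_assoc, mul_inv_cancel₀ hdQ.ne', mul_one]

theorem conv_conv_J_of_conv_eq (hd : 𝓕.IsDimension) {P Q W : A} (hP : IsStarProjection P)
    (hQ : IsStarProjection Q) (hW : IsStarProjection W) (h : 𝓕.conv P Q = 𝓕.d Q • W)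
    (hdW : 𝓕.d W = 𝓕.d P) : 𝓕.conv (𝓕.conv P Q) (𝓕.J Q) = (𝓕.d Q ^ 2) • P := by
  have hJQ := 𝓕.J_nonneg hQ.nonneg
  have h0 := 𝓕.conv_nonneg hW.nonneg hJQ
  -- By reciprocity, `P` captures the full `d`-mass of `W * J Q`.
  have h1 : P * 𝓕.conv W (𝓕.J Q) = 𝓕.conv W (𝓕.J Q) := by
    refine 𝓕.eq_of_le_of_d_le ?_ ?_
    · have := CommCStarAlgebra.mul_nonneg hP.one_sub_nonneg h0
      rwa [sub_mul, one_mul, sub_nonneg] at this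
    · rw [𝓕.d_mul_conv hP.nonneg hJQ, J_J, h, smul_mul_assoc, hW.isIdempotentElem.eq, d_conv hd,
        map_smul, smul_eq_mul, d_J_of_nonneg hQ.nonneg, mul_comm]
  rw [h, smul_conv, conv_eq_smul_of_d_le hd hW.le_one hJQ hP.nonneg h1 hdW.ge,
    d_J_of_nonneg hQ.nonneg, smul_smul, sq]

/-! ### From equality to a biprojection. -/

theorem d_symm_projection_mul_self {f : B} (hf : IsStarProjection f)
    (hF : 0 ≤ 𝓕.fourier.symm f) : 𝓕.d (𝓕.fourier.symm f * 𝓕.fourier.symm f) = 𝓕.τ f := by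
  rw [𝓕.d_mul hF.isSelfAdjoint, LinearEquiv.apply_symm_apply, hf.isSelfAdjoint.star_eq,
    hf.isIdempotentElem.eq]

theorem τ_projection_pos {f : B} (hf : IsStarProjection f) (hf0 : f ≠ 0) : 0 < 𝓕.τ f := by
  have h : star f * f = f := by rw [hf.isSelfAdjoint.star_eq, hf.isIdempotentElem.eq]
  refine lt_of_le_of_ne (h ▸ 𝓕.τ_trace.nonneg f) fun h0 => hf0 (𝓕.τ_trace.faithful f ?_)
  rw [h, ← h0]

theorem symm_projection_le (hd : 𝓕.IsDimension) {f : B} (hf : IsStarProjection f)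
    (hF : 0 ≤ 𝓕.fourier.symm f) : 𝓕.fourier.symm f ≤ 𝓕.τ f • 1 := by
  rw [← sub_nonneg, CommCStarAlgebra.nonneg_iff_characters]
  intro χ
  rw [map_sub, map_smul, map_one, smul_eq_mul, mul_one, sub_nonneg]
  obtain ⟨p, hp, -, hpm⟩ := exists_isMinimalProjection_character χ
  have hk : 𝓕.τ (star (𝓕.fourier p) * f) = χ (𝓕.fourier.symm f) * 𝓕.d p := by
    rw [← 𝓕.fourier.apply_symm_apply f, ← 𝓕.d_mul hp.1.isSelfAdjoint, mul_comm, hpm, map_smul,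
      smul_eq_mul, LinearEquiv.symm_apply_apply]
  have hχ := CommCStarAlgebra.nonneg_iff_characters.1 hF χ
  have hdp : 0 < 𝓕.d p := 𝓕.d_pos hp.1.nonneg hp.2.1
  have hk' : 𝓕.τ (𝓕.fourier p * f) = χ (𝓕.fourier.symm f) * 𝓕.d p := by
    rw [𝓕.τ_trace.trace]
    have := congrArg star hk
    rwa [← 𝓕.τ_trace.map_star, star_mul, star_star, hf.isSelfAdjoint.star_eq, star_mul',
      (IsSelfAdjoint.of_nonneg hχ).star_eq, (IsSelfAdjoint.of_nonneg hdp.le).star_eq] at this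
  -- Compressing `𝔉 p + (𝔉 p)^* ≤ 2 ‖𝔉 p‖` by `f` and taking `τ` bounds the value of `𝔉⁻¹ f` at `χ`,
  -- as `‖𝔉 p‖ = d p`.
  obtain ⟨s, hs⟩ := exists_star_mul_self_eq_sub_add_star (𝓕.fourier p)
  have h1 := 𝓕.τ_trace.nonneg (s * f)
  rw [star_mul, hf.isSelfAdjoint.star_eq, mul_assoc, 𝓕.τ_trace.trace, mul_assoc, mul_assoc,
    hf.isIdempotentElem.eq, ← mul_assoc, hs, sub_mul, add_mul, smul_mul_assoc, one_mul, map_sub,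
    map_add, hk, hk', map_smul, ← hd p hp, smul_eq_mul] at h1
  refine le_of_mul_le_mul_left (sub_nonneg.1 (h1.trans_eq ?_)) (mul_pos two_pos hdp)
  ring

/-- A projection of `B` in the positive cone of `A` comes from a biprojection. -/
theorem symm_projection_mul_self (hd : 𝓕.IsDimension) {f : B} (hf : IsStarProjection f)
    (hf0 : f ≠ 0) (hF : 0 ≤ 𝓕.fourier.symm f) : 𝓕.d (𝓕.fourier.symm f) = 1 ∧
      𝓕.fourier.symm f * 𝓕.fourier.symm f = 𝓕.τ f • 𝓕.fourier.symm f := by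
  have h1 : 𝓕.d (𝓕.fourier.symm f) = 1 := by
    have h2 : 𝓕.conv (𝓕.fourier.symm f) (𝓕.fourier.symm f) = 𝓕.fourier.symm f := by
      simp [conv, hf.isIdempotentElem.eq]
    have h3 := d_conv hd (𝓕.fourier.symm f) (𝓕.fourier.symm f)
    rw [h2] at h3
    have h4 : 𝓕.d (𝓕.fourier.symm f) ≠ 0 := (𝓕.d_pos hF (by simpa using hf0)).ne'
    exact (mul_eq_left₀ h4).1 h3.symm
  refine ⟨h1, mul_self_eq_smul_of_le (𝓕 := 𝓕) hF (symm_projection_le hd hf hF) ?_⟩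
  rw [d_symm_projection_mul_self hf hF, h1, mul_one]

theorem exists_biprojection_of_conv_eq (hd : 𝓕.IsDimension) {P Q W : A}
    (hP : IsStarProjection P) (hQ : IsStarProjection Q) (hW : IsStarProjection W) (hP0 : P ≠ 0)
    (hQ0 : Q ≠ 0) (h : 𝓕.conv P Q = 𝓕.d Q • W) (hdW : 𝓕.d W = 𝓕.d P) :
    ∃ E : A, 𝓕.IsBiprojection E ∧ (∃ R : A, 𝓕.IsRightShift E R ∧ Q ≤ R) ∧
      ∃ x : A, x ≠ 0 ∧ P = rangeProjection (𝓕.conv x E) := by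
  have hdQ : 0 < 𝓕.d Q := 𝓕.d_pos hQ.nonneg hQ0
  obtain ⟨δ, hδ⟩ : ∃ δ : ℝ, 𝓕.d Q = δ := ⟨_, Complex.eq_re_of_ofReal_le hdQ.le⟩
  have hδ0 : 0 < δ := by rw [hδ] at hdQ; exact_mod_cast hdQ
  have hr : 0 < δ ^ 2 := by positivity
  have hq : ‖𝓕.fourier Q‖ ^ 2 ≤ δ ^ 2 := by
    have := norm_fourier_le hd hQ.nonneg
    rw [hδ] at this
    exact pow_le_pow_left₀ (norm_nonneg _) (by exact_mod_cast this) 2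
  have hδr : ((δ ^ 2 : ℝ) : ℂ) = 𝓕.d Q ^ 2 := by rw [hδ, Complex.ofReal_pow]
  obtain ⟨f, hf, hqf, hlim, -⟩ := exists_tendsto_pow_projection (𝓕.fourier Q) hr hq
  rw [hδr] at hqf hlim
  have hF : 0 ≤ 𝓕.fourier.symm f :=
    nonneg_of_tendsto_pow (inv_nonneg.2 (pow_nonneg hdQ.le 2)) (by simpa using hQ.nonneg) hlim
  have hPQ : 𝓕.fourier P * ((𝓕.d Q ^ 2)⁻¹ • (𝓕.fourier Q * star (𝓕.fourier Q))) =
      𝓕.fourier P := by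
    have := congrArg 𝓕.fourier (conv_conv_J_of_conv_eq hd hP hQ hW h hdW)
    rw [fourier_conv, fourier_conv, fourier_J, map_smul, mul_assoc] at this
    rw [mul_smul_comm, this, smul_smul, inv_mul_cancel₀ (pow_ne_zero 2 hdQ.ne'), one_smul]
  have hPf : 𝓕.fourier P * f = 𝓕.fourier P := by
    have h1 (n : ℕ) : 𝓕.fourier P *
        ((𝓕.d Q ^ 2)⁻¹ • (𝓕.fourier Q * star (𝓕.fourier Q))) ^ n = 𝓕.fourier P := by
      induction n with
      | zero => rw [pow_zero, mul_one]
      | succ n ih => rw [pow_succ, ← mul_assoc, ih, hPQ]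
    have h2 := hlim.const_mul (𝓕.fourier P)
    simp only [h1] at h2
    exact tendsto_nhds_unique h2 tendsto_const_nhds
  have hf0 : f ≠ 0 := by
    rintro rfl
    rw [mul_zero] at hPf
    exact hP0 (by simpa using hPf.symm)
  have hτ : 0 < 𝓕.τ f := τ_projection_pos hf hf0
  obtain ⟨hdF, hFF⟩ := symm_projection_mul_self hd hf hf0 hF
  set F := 𝓕.fourier.symm f with hFdef
  have hfF : 𝓕.fourier F = f := 𝓕.fourier.apply_symm_apply f
  have hE := CommCStarAlgebra.isStarProjection_inv_smul hF hτ hFF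
  set Y := 𝓕.conv F Q with hYdef
  have hY : 0 ≤ Y := 𝓕.conv_nonneg hF hQ.nonneg
  have hdY : 𝓕.d Y = 𝓕.d Q := by rw [d_conv hd, hdF, one_mul]
  have hFY : 𝓕.conv F Y = Y := by
    rw [← conv_assoc]
    congr 1
    simp [conv, hf.isIdempotentElem.eq, hFdef]
  have hYle : Y ≤ (𝓕.τ f * 𝓕.d Q) • (1 : A) := by
    refine (𝓕.conv_le_conv_left hQ.nonneg (symm_projection_le hd hf hF)).trans_eq ?_
    rw [smul_conv, one_conv hd, smul_smul]
  -- The upper bound on `Y` is attained in trace because `f 𝔉(Q) 𝔉(Q)^* f = d(Q)² f`.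
  have hYY : Y * Y = (𝓕.τ f * 𝓕.d Q) • Y := by
    refine mul_self_eq_smul_of_le (𝓕 := 𝓕) hY hYle ?_
    rw [𝓕.d_mul hY.isSelfAdjoint, fourier_conv, hfF, 𝓕.τ_trace.trace, star_mul,
      hf.isSelfAdjoint.star_eq, mul_assoc, ← mul_assoc _ _ f, hqf, mul_smul_comm, map_smul,
      hf.isIdempotentElem.eq, hdY, smul_eq_mul]
    ring
  have hc : 0 < 𝓕.τ f * 𝓕.d Q := mul_pos hτ hdQ
  have hR := CommCStarAlgebra.isStarProjection_inv_smul hY hc hYY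
  refine ⟨(𝓕.τ f)⁻¹ • F, ⟨hE, (𝓕.τ f)⁻¹, f, hf, by rw [map_smul, hfF]⟩,
    ⟨(𝓕.τ f * 𝓕.d Q)⁻¹ • Y, ⟨hR, ?_, ?_⟩, hQ.le_of_mul_eq_right hR ?_⟩, P, hP0, ?_⟩
  · rw [map_smul, map_smul, hdF, hdY, smul_eq_mul, smul_eq_mul, mul_inv, mul_assoc,
      inv_mul_cancel₀ hdQ.ne']
  · rw [smul_conv, conv_smul, hFY, map_smul, hdF, smul_eq_mul, mul_one]
  -- `F` dominates `τ(f) e`, a multiple of the convolution unit, so `Y = F * Q` dominates a positive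
  -- multiple of `Q`.
  · obtain ⟨c, e, hc0, he, -, hfe, hz⟩ := 𝓕.exists_unit hd
    have h1 : 𝓕.τ f • e ≤ F := by
      rw [← hfF, ← hz]
      have := CommCStarAlgebra.mul_nonneg hF he.one_sub_nonneg
      rwa [mul_sub, mul_one, sub_nonneg] at this
    have h2 := 𝓕.conv_le_conv_left hQ.nonneg h1
    have h3 : 𝓕.conv (𝓕.τ f • e) Q = (𝓕.τ f * (c : ℂ)⁻¹) • Q := by
      apply 𝓕.fourier.injective
      rw [fourier_conv, map_smul, hfe, map_smul, smul_smul, smul_mul_assoc, one_mul]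
    have hk : 0 < 𝓕.τ f * (c : ℂ)⁻¹ := mul_pos hτ (inv_pos.2 (by exact_mod_cast hc0))
    rw [h3] at h2
    have h4 := hR.mul_eq_self_of_le
      (CommCStarAlgebra.complex_smul_nonneg hk.le hQ.nonneg) h2
      (by rw [smul_mul_assoc, hYY, smul_smul, inv_mul_cancel₀ hc.ne', one_smul])
    rw [mul_smul_comm] at h4
    exact smul_right_injective A hk.ne' h4
  · have h1 : 𝓕.conv P ((𝓕.τ f)⁻¹ • F) = (𝓕.τ f)⁻¹ • P := by
      apply 𝓕.fourier.injective
      rw [fourier_conv, map_smul, hfF, mul_smul_comm, hPf, map_smul]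
    rw [h1, rangeProjection_smul_projection hP (inv_ne_zero hτ.ne')]

/-! ### From a biprojection back to equality. -/

theorem IsBiprojection.fourier_eq (hd : 𝓕.IsDimension) {E : A} (hE : 𝓕.IsBiprojection E)
    (hE0 : E ≠ 0) : ∃ p : B, IsStarProjection p ∧ 𝓕.fourier E = 𝓕.d E • p ∧
      𝓕.d E * 𝓕.τ p = 1 := by
  obtain ⟨hEp, c, p, hp, hc⟩ := hE
  have hdE : 0 < 𝓕.d E := 𝓕.d_pos hEp.nonneg hE0
  have h1 : 𝓕.conv E E = c • E := by
    apply 𝓕.fourier.injective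
    rw [fourier_conv, map_smul, hc, smul_mul_smul_comm, hp.isIdempotentElem.eq, smul_smul]
  have h2 := d_conv hd E E
  rw [h1, map_smul, smul_eq_mul] at h2
  have h3 : c = 𝓕.d E := mul_right_cancel₀ hdE.ne' h2
  rw [h3] at hc
  refine ⟨p, hp, hc, ?_⟩
  have h4 := 𝓕.d_mul hEp.isSelfAdjoint E
  rw [hEp.isIdempotentElem.eq, hc, star_smul, smul_mul_smul_comm, hp.isSelfAdjoint.star_eq,
    hp.isIdempotentElem.eq, map_smul, (IsSelfAdjoint.of_nonneg hdE.le).star_eq, smul_eq_mul,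
    mul_assoc] at h4
  exact ((mul_eq_left₀ hdE.ne').1 h4.symm)

/-- With `r = 𝔉 R` and `p` the projection under `𝔉 E`, one has `p r = r` and `‖r‖ ≤ d(E)`, so `r r^*
≤ d(E)² p`. Both sides have trace `d(E)`, hence agree. -/
theorem IsRightShift.conv_J (hd : 𝓕.IsDimension) {E R : A} (hE : 𝓕.IsBiprojection E)
    (hE0 : E ≠ 0) (hR : 𝓕.IsRightShift E R) : 𝓕.conv R (𝓕.J R) = 𝓕.d E • E := by
  obtain ⟨p, hp, hEp, hτ⟩ := hE.fourier_eq hd hE0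
  obtain ⟨hRp, hdR, hER⟩ := hR
  have hdE : 0 < 𝓕.d E := 𝓕.d_pos hE.1.nonneg hE0
  obtain ⟨δ, hδ⟩ : ∃ δ : ℝ, 𝓕.d E = δ := ⟨_, Complex.eq_re_of_ofReal_le hdE.le⟩
  have hr : ‖𝓕.fourier R‖ ^ 2 ≤ δ ^ 2 := by
    have := norm_fourier_le hd hRp.nonneg
    rw [← hdR, hδ] at this
    exact pow_le_pow_left₀ (norm_nonneg _) (by exact_mod_cast this) 2
  obtain ⟨s, hs⟩ := exists_star_mul_self_eq_sub_mul_star (𝓕.fourier R) hr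
  rw [Complex.ofReal_pow, ← hδ] at hs
  have hpr : p * 𝓕.fourier R = 𝓕.fourier R := by
    have := congrArg 𝓕.fourier hER
    rw [fourier_conv, hEp, map_smul, smul_mul_assoc] at this
    exact smul_right_injective B hdE.ne' this
  have hrp : star (𝓕.fourier R) * p = star (𝓕.fourier R) := by
    have := congrArg star hpr
    rwa [star_mul, hp.isSelfAdjoint.star_eq] at this
  have h1 : star (s * p) * (s * p) =
      (𝓕.d E ^ 2) • p - 𝓕.fourier R * star (𝓕.fourier R) := by
    rw [star_mul, hp.isSelfAdjoint.star_eq, mul_assoc, ← mul_assoc (star s), hs, sub_mul, mul_sub,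
      smul_mul_assoc, one_mul, mul_smul_comm, hp.isIdempotentElem.eq, mul_assoc, hrp, ← mul_assoc,
      hpr]
  have h2 : s * p = 0 := by
    apply 𝓕.τ_trace.faithful
    rw [h1, map_sub, map_smul, 𝓕.τ_trace.trace, ← 𝓕.d_mul hRp.isSelfAdjoint,
      hRp.isIdempotentElem.eq, ← hdR, smul_eq_mul, sq, mul_assoc, hτ, mul_one, sub_self]
  rw [h2, mul_zero, eq_comm, sub_eq_zero] at h1
  apply 𝓕.fourier.injective
  rw [fourier_conv, fourier_J, ← h1, map_smul, hEp, smul_smul, sq]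

theorem IsBiprojection.conv_self (hd : 𝓕.IsDimension) {E : A} (hE : 𝓕.IsBiprojection E)
    (hE0 : E ≠ 0) : 𝓕.conv E E = 𝓕.d E • E := by
  obtain ⟨p, hp, hEp, -⟩ := hE.fourier_eq hd hE0
  apply 𝓕.fourier.injective
  rw [fourier_conv, map_smul, hEp, smul_mul_smul_comm, hp.isIdempotentElem.eq, smul_smul]

/-- Equality in the Kadison-Schwarz inequality for fixed points. -/
theorem conv_mul_star_self_of_conv_eq_smul (hd : 𝓕.IsDimension) {E z : A} (hE : 0 ≤ E)
    (h : 𝓕.conv z E = 𝓕.d E • z) : 𝓕.conv (z * star z) E = 𝓕.d E • (z * star z) := by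
  have hdE := 𝓕.d_nonneg hE
  have h' : 𝓕.conv (star z) E = 𝓕.d E • star z := by
    have := congrArg star h
    rwa [star_conv, hE.isSelfAdjoint.star_eq, star_smul,
      (IsSelfAdjoint.of_nonneg hdE).star_eq] at this
  refine (𝓕.eq_of_le_of_d_le (sub_nonneg.1 ?_) ?_).symm
  · rw [CommCStarAlgebra.nonneg_iff_characters]
    intro χ
    -- Centering `z` at its value under `χ` yields the Schwarz inequality at that character;
    -- multiplicativity of `d` then turns it into an equality.
    have h1 := 𝓕.conv_nonneg (mul_star_self_nonneg (z - χ z • 1)) hE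
    have h2 : (z - χ z • 1) * star (z - χ z • 1) =
        z * star z - star (χ z) • z - χ z • star z + (χ z * star (χ z)) • 1 := by
      simp only [star_sub, star_smul, star_one, sub_mul, mul_sub, smul_mul_assoc, mul_smul_comm,
        one_mul, mul_one, smul_sub, smul_smul]
      rw [mul_comm (star (χ z))]
      abel
    rw [h2, add_conv, sub_conv, sub_conv, smul_conv, smul_conv, smul_conv, h, h',
      one_conv hd] at h1
    have h3 := CommCStarAlgebra.nonneg_iff_characters.1 h1 χ
    simp only [map_add, map_sub, map_smul, map_star, map_one, smul_eq_mul] at h3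
    simp only [map_sub, map_smul, map_mul, map_star, smul_eq_mul]
    refine h3.trans_eq ?_
    ring
  · rw [d_conv hd, map_smul, smul_eq_mul, mul_comm]

theorem conv_rangeProjection_of_conv_eq_smul (hd : 𝓕.IsDimension) {E z : A} (hE : 0 ≤ E)
    (h : 𝓕.conv z E = 𝓕.d E • z) :
    𝓕.conv (rangeProjection z) E = 𝓕.d E • rangeProjection z := by
  have hP := isStarProjection_rangeProjection z
  obtain ⟨c, hc, hle⟩ := exists_rangeProjection_le_smul z
  refine conv_eq_smul_of_d_le hd hP.le_one hE hP.nonneg ?_ le_rfl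
  refine hP.mul_eq_self_of_le (𝓕.conv_nonneg hP.nonneg hE) (𝓕.conv_le_conv_left hE hle) ?_
  rw [smul_conv, conv_mul_star_self_of_conv_eq_smul hd hE h, mul_smul_comm, mul_smul_comm,
    ← mul_assoc, rangeProjection_mul_self]

theorem supp_conv_of_biprojection (hd : 𝓕.IsDimension) {P Q E R x : A}
    (hP : IsStarProjection P) (hQ : IsStarProjection Q) (hQ0 : Q ≠ 0) (hE : 𝓕.IsBiprojection E)
    (hR : 𝓕.IsRightShift E R) (hQR : Q ≤ R) (hx : P = rangeProjection (𝓕.conv x E)) :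
    𝓕.supp (𝓕.conv P Q) = 𝓕.supp P := by
  have hR0 : R ≠ 0 := fun h => hQ0 (le_antisymm (h ▸ hQR) hQ.nonneg)
  have hRn := hR.1.nonneg
  have hJR := 𝓕.J_nonneg hRn
  have hdR : 0 < 𝓕.d R := 𝓕.d_pos hRn hR0
  have hE0 : E ≠ 0 := fun h => by
    have := hR.2.1
    rw [h, map_zero] at this
    exact hdR.ne this
  have hPE : 𝓕.conv P E = 𝓕.d E • P := by
    rw [hx]
    refine conv_rangeProjection_of_conv_eq_smul hd hE.1.nonneg ?_
    rw [conv_assoc, hE.conv_self hd hE0, conv_smul]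
  have hPRJ : 𝓕.conv (𝓕.conv P R) (𝓕.J R) = (𝓕.d E * 𝓕.d E) • P := by
    rw [conv_assoc, hR.conv_J hd hE hE0, conv_smul, hPE, smul_smul]
  have hPR := 𝓕.conv_nonneg hP.nonneg hRn
  have hW := isStarProjection_rangeProjection (𝓕.conv P R)
  have hWm := rangeProjection_mul_self (𝓕.conv P R)
  obtain ⟨c, hc, hle⟩ := exists_rangeProjection_le_smul (𝓕.conv P R)
  set W := rangeProjection (𝓕.conv P R)
  -- With `y = P * R`, the bound `y ≤ d(R) 1` turns `W ≤ c y²` into a bound linear in `y`, to which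
  -- convolution by `J R` applies.
  have hle' : W ≤ (c * 𝓕.d R) • 𝓕.conv P R := by
    refine hle.trans ?_
    rw [hPR.star_eq, mul_smul, ← sub_nonneg, ← smul_sub]
    exact CommCStarAlgebra.complex_smul_nonneg hc (sub_nonneg.2
      (CommCStarAlgebra.mul_le_of_le_smul_one hPR (conv_le_smul_one hd hP.le_one hRn)))
  have hPW : P * 𝓕.conv W (𝓕.J R) = 𝓕.conv W (𝓕.J R) := by
    refine hP.mul_eq_self_of_le (𝓕.conv_nonneg hW.nonneg hJR) (𝓕.conv_le_conv_left hJR hle') ?_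
    rw [smul_conv, hPRJ, mul_smul_comm, mul_smul_comm, hP.isIdempotentElem.eq]
  have hWP : 𝓕.d W ≤ 𝓕.d P := d_le_of_mul_conv_eq_self hd hW.le_one hJR
    (fun h => hR0 (by rw [← 𝓕.J_J R, h, J_zero])) hP.nonneg hPW
  rw [supp_projection hP]
  refine le_antisymm (le_trans (𝓕.d_mono (rangeProjection_le hW ?_)) hWP)
    (d_le_of_mul_conv_eq_self hd hP.le_one hQ.nonneg hQ0
      (isStarProjection_rangeProjection _).nonneg (rangeProjection_mul_self _))
  exact hW.mul_eq_self_of_le (𝓕.conv_nonneg hP.nonneg hQ.nonneg)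
    (𝓕.conv_le_conv_right hP.nonneg hQR) hWm

end FusionBialgebra

theorem mainTheorem9 {A B : Type*} [CommCStarAlgebra A] [PartialOrder A] [StarOrderedRing A]
    [FiniteDimensional ℂ A] [CStarAlgebra B] [FiniteDimensional ℂ B]
    (𝓕 : FusionBialgebra A B) (hd : 𝓕.IsDimension)
    (P Q : A) (hP : IsStarProjection P) (hQ : IsStarProjection Q) (hP0 : P ≠ 0) (hQ0 : Q ≠ 0) :
    [𝓕.supp (𝓕.conv P Q) = 𝓕.supp P,
      IsStarProjection ((𝓕.supp Q)⁻¹ • 𝓕.conv P Q),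
      ∃ E : A, 𝓕.IsBiprojection E ∧
        (∃ R : A, 𝓕.IsRightShift E R ∧ Q ≤ R) ∧
        ∃ x : A, x ≠ 0 ∧ P = rangeProjection (𝓕.conv x E)].TFAE := by
  tfae_have 1 ↔ 2 := FusionBialgebra.supp_conv_eq_iff hd hP hQ hQ0
  tfae_have 1 → 3 := fun h => by
    rw [FusionBialgebra.supp_projection hP] at h
    have hW := isStarProjection_rangeProjection (𝓕.conv P Q)
    exact FusionBialgebra.exists_biprojection_of_conv_eq hd hP hQ hW hP0 hQ0
      (FusionBialgebra.conv_eq_smul_of_d_le hd hP.le_one hQ.nonneg hW.nonneg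
        (rangeProjection_mul_self _) h.le) h
  tfae_have 3 → 1 := fun ⟨E, hE, ⟨R, hR, hQR⟩, x, _, hx⟩ =>
    FusionBialgebra.supp_conv_of_biprojection hd hP hQ hQ0 hE hR hQR hx
  tfae_finish
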